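/- Conventions. Let $\{0,1\}^*$ be the set of finite binary strings, $|x|$ the length of $x$, and $\{0,1\}^{\mathbb N}$ the set of infinite binary sequences $\mathbf x=\mathbf x_1\mathbf x_2\cdots$, with prefixes $\mathbf x_{1:n}=\mathbf x_1\cdots\mathbf x_n$. Put $\langle x,y\rangle=1^{|x|}0xy$ for $x,y\in\{0,1\}^*$. A partial function $\varphi:\{0,1\}^*\times\{0,1\}^{\mathbb N}\rightharpoonup\{0,1\}^*$ is called computable if a single algorithm computes $\varphi(x,\mathbf o)$ from the input $x$ with oracle $\mathbf o$, for all $x$ and $\mathbf o$. A computable $U$ is universal if for every computable $\varphi$ there is a $p\in\{0,1\}^*$ with $\varphi(x,\mathbf o)=U(\langle p,x\rangle,\mathbf o)$ for all $x$ and $\mathbf o$ (both sides being undefined for the same arguments). Fix any universal $U$ and let $K[x\mid\mathbf o]=\min\{|w| : U(w,\mathbf o)=x\}$. For $\beta\in(1,2]$ and $s\in[0,\frac1{\beta-1}]$, a $\beta$-expansion of $s$ is an $\mathbf x\in\{0,1\}^{\mathbb N}$ with $s=\sum_{i\ge1}\mathbf x_i\beta^{-i}$. The greedy $\beta$-expansion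 of $s$ is the lexicographically largest one; for $\beta=2$ it is called the greedy binary expansion. For $\beta\in(1,2)$ let $K[x\mid\beta]=K[x\mid\mathbf y_\beta]$, where $\mathbf y_\beta$ is the greedy binary expansion of $\beta-1$, and let $n(\beta)=\lceil n\log_\beta 2\rceil$. For $\mathbf x\in\{0,1\}^{\mathbb N}$ with $s=\sum_{i\ge1}\mathbf x_i\beta^{-i}\in[0,1]$ and greedy binary expansion $\mathbf y$ of $s$, let $$\underline\Delta_\beta(\mathbf x)=\liminf_{n\to\infty}\frac{K[\mathbf x_{1:n(\beta)}\mid\beta]-K[\mathbf y_{1:n}\mid\beta]}{n},\qquad \overline\Delta_\beta(\mathbf x)=\limsup_{n\to\infty}\frac{K[\mathbf x_{1:n(\beta)}\mid\beta]-K[\mathbf y_{1:n}\mid\beta]}{n}.$$ A Pisot number is a real algebraic integer greater than $1$ all of whose other Galois conjugates lie strictly inside the unit disk of $\mathbb C$. Statement. Let $\beta\in(1,2)$ be a Pisot number, let $s\in[0,1]$, and let $\mathbf x$ be the greedy $\beta$-expansion of $s$. Then $$\underline\Delta_\beta(\mathbf x)=\overline\Delta_\beta(\mathbf x)=0.$$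 -/

import Mathlib

noncomputable section

namespace BetaExpansion

/-! ### Expansions of real numbers in base `β`

Infinite binary sequences are functions `ℕ → Bool`; the value at `i` is the `(i+1)`-st digit. -/

/-- `x` is a `β`-expansion of `s`: the series of the digits of `x`, the `i`-th one (counted from
`1`) divided by `β ^ i`, converges to `s`. -/
def IsExpansion (β s : ℝ) (x : ℕ → Bool) : Prop :=
  HasSum (fun i : ℕ => ((x i).toNat : ℝ) / β ^ (i + 1)) s

/-- The real number represented by the digit sequence `x` in base `β`. -/
def value (β : ℝ) (x : ℕ → Bool) : ℝ :=
  ∑' i : ℕ, ((x i).toNat : ℝ) / β ^ (i + 1)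

/-- `x` is the greedy `β`-expansion of `s`: the lexicographically largest `β`-expansion of `s`. -/
def IsGreedyExpansion (β s : ℝ) (x : ℕ → Bool) : Prop :=
  IsExpansion β s x ∧ ∀ z : ℕ → Bool, IsExpansion β s z → toLex z ≤ toLex x

/-- The remainder of the greedy algorithm after `n` steps. -/
def greedyRemainder (β s : ℝ) : ℕ → ℝ
  | 0 => s
  | n + 1 =>
      if greedyRemainder β s n < β⁻¹ then β * greedyRemainder β s n
      else β * greedyRemainder β s n - 1

/-- The digits delivered by the greedy algorithm. By `isGreedyExpansion_iff` below this is the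
greedy `β`-expansion of `s` for all `1 < β` with `β ≤ 2` and all `s` in `[0, 1 / (β - 1)]`. -/
def greedyExpansion (β s : ℝ) (n : ℕ) : Bool :=
  open Classical in decide (β⁻¹ ≤ greedyRemainder β s n)

theorem greedyRemainder_succ {β s : ℝ} (n : ℕ) :
    greedyRemainder β s (n + 1)
      = β * greedyRemainder β s n - ((greedyExpansion β s n).toNat : ℝ) := by
  by_cases h : greedyRemainder β s n < β⁻¹
  · simp [greedyRemainder, greedyExpansion, h, not_le.mpr h]
  · simp [greedyRemainder, greedyExpansion, h, not_lt.mp h]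

theorem greedyRemainder_mem {β s : ℝ} (h1 : 1 < β) (h2 : β ≤ 2)
    (hs : s ∈ Set.Icc 0 (1 / (β - 1))) (n : ℕ) :
    greedyRemainder β s n ∈ Set.Icc 0 (1 / (β - 1)) := by
  have hb : 0 < β - 1 := by linarith
  have hb0 : 0 < β := by linarith
  induction n with
  | zero => exact hs
  | succ n ih =>
    obtain ⟨ih0, ih1⟩ := ih
    rw [le_div_iff₀ hb] at ih1
    by_cases h : greedyRemainder β s n < β⁻¹
    · have hr : β * greedyRemainder β s n < 1 := by
        have := mul_lt_mul_of_pos_left h hb0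
        rwa [mul_inv_cancel₀ hb0.ne'] at this
      simp only [greedyRemainder, h, if_true]
      refine ⟨by positivity, ?_⟩
      rw [le_div_iff₀ hb]
      nlinarith
    · have hr : 1 ≤ β * greedyRemainder β s n := by
        have := mul_le_mul_of_nonneg_left (not_lt.mp h) hb0.le
        rwa [mul_inv_cancel₀ hb0.ne'] at this
      simp only [greedyRemainder, h, if_false]
      refine ⟨by linarith, ?_⟩
      rw [le_div_iff₀ hb]
      nlinarith

theorem sum_greedyExpansion {β s : ℝ} (h1 : 1 < β) (n : ℕ) :
    ∑ i ∈ Finset.range n, ((greedyExpansion β s i).toNat : ℝ) / β ^ (i + 1)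
      = s - greedyRemainder β s n / β ^ n := by
  have hb0 : β ≠ 0 := by linarith
  induction n with
  | zero => simp [greedyRemainder]
  | succ n ih =>
    rw [Finset.sum_range_succ, ih, greedyRemainder_succ]
    field_simp
    ring

theorem isExpansion_greedyExpansion {β s : ℝ} (h1 : 1 < β) (h2 : β ≤ 2)
    (hs : s ∈ Set.Icc 0 (1 / (β - 1))) : IsExpansion β s (greedyExpansion β s) := by
  have hb0 : 0 < β := by linarith
  unfold IsExpansion
  rw [hasSum_iff_tendsto_nat_of_nonneg (fun i => by positivity)]
  simp_rw [sum_greedyExpansion h1]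
  have hz : Filter.Tendsto (fun n : ℕ => greedyRemainder β s n / β ^ n) Filter.atTop
      (nhds 0) := by
    have hc : Filter.Tendsto (fun n : ℕ => (1 / (β - 1)) * (β⁻¹) ^ n) Filter.atTop
        (nhds ((1 / (β - 1)) * 0)) :=
      (tendsto_pow_atTop_nhds_zero_of_lt_one (by positivity)
        (inv_lt_one_of_one_lt₀ h1)).const_mul _
    rw [mul_zero] at hc
    refine squeeze_zero (fun n => ?_) (fun n => ?_) hc
    · exact div_nonneg (greedyRemainder_mem h1 h2 hs n).1 (by positivity)
    · rw [inv_pow, ← div_eq_mul_inv]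
      exact div_le_div_of_nonneg_right (greedyRemainder_mem h1 h2 hs n).2 (by positivity)
  simpa using hz.const_sub s

theorem isGreedyExpansion_greedyExpansion {β s : ℝ} (h1 : 1 < β) (h2 : β ≤ 2)
    (hs : s ∈ Set.Icc 0 (1 / (β - 1))) : IsGreedyExpansion β s (greedyExpansion β s) := by
  have hb0 : 0 < β := by linarith
  refine ⟨isExpansion_greedyExpansion h1 h2 hs, fun z hz => ?_⟩
  by_contra hlt
  obtain ⟨j, hj, hjlt⟩ := not_le.mp hlt
  have hj' : ∀ i < j, greedyExpansion β s i = z i := hj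
  have hjlt' : greedyExpansion β s j < z j := hjlt
  obtain ⟨hg, hzj⟩ := Bool.lt_iff.mp hjlt'
  have hle := sum_le_hasSum (Finset.range (j + 1)) (fun i _ => by positivity) hz
  rw [Finset.sum_range_succ, hzj] at hle
  have hsum : ∑ i ∈ Finset.range j, ((z i).toNat : ℝ) / β ^ (i + 1)
      = s - greedyRemainder β s j / β ^ j := by
    rw [← sum_greedyExpansion h1]
    refine Finset.sum_congr rfl fun i hi => ?_
    rw [hj' i (Finset.mem_range.mp hi)]
  rw [hsum] at hle
  have hr : greedyRemainder β s j < β⁻¹ := by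
    simpa [greedyExpansion] using hg
  have hp : 0 < β ^ j := by positivity
  have h3 : greedyRemainder β s j / β ^ j < β⁻¹ / β ^ j := div_lt_div_of_pos_right hr hp
  have h4 : ((true.toNat : ℕ) : ℝ) / β ^ (j + 1) = β⁻¹ / β ^ j := by
    simp only [Bool.toNat_true, Nat.cast_one]
    field_simp
    ring
  rw [h4] at hle
  linarith

/-- The greedy algorithm delivers the lexicographically largest expansion, and nothing else is
one. -/
theorem isGreedyExpansion_iff {β s : ℝ} (h1 : 1 < β) (h2 : β ≤ 2)
    (hs : s ∈ Set.Icc 0 (1 / (β - 1))) (x : ℕ → Bool) :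
    IsGreedyExpansion β s x ↔ x = greedyExpansion β s := by
  have hg := isGreedyExpansion_greedyExpansion h1 h2 hs
  constructor
  · intro hx
    exact toLex.injective (le_antisymm (hg.2 x hx.1) (hx.2 _ hg.1))
  · rintro rfl
    exact hg

/-- A Pisot number: a real algebraic integer greater than `1` all of whose Galois conjugates (the
complex roots, other than the number itself, of its minimal polynomial) lie strictly inside the
unit disk. -/
def IsPisot (β : ℝ) : Prop :=
  IsIntegral ℤ β ∧ 1 < β ∧
    ∀ z : ℂ, Polynomial.aeval z (minpoly ℚ β) = 0 → z ≠ (β : ℂ) → ‖z‖ < 1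

/-! ### Computability with an infinite binary sequence as oracle -/

/-- Partial functions on `ℕ` that are computed by one and the same algorithm for all oracles
`o : ℕ → Bool`. This is Mathlib's `Nat.RecursiveIn`, made uniform in the oracle: the algorithm may
ask for the digits of `o` but must not depend on `o` otherwise. -/
inductive OraclePartrec : ((ℕ → Bool) → ℕ →. ℕ) → Prop
  | zero : OraclePartrec fun _ _ => Part.some 0
  | succ : OraclePartrec fun _ n => Part.some (n + 1)
  | left : OraclePartrec fun _ n => Part.some n.unpair.1
  | right : OraclePartrec fun _ n => Part.some n.unpair.2
  | oracle : OraclePartrec fun o n => Part.some (o n).toNat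
  | pair {f h : (ℕ → Bool) → ℕ →. ℕ} (hf : OraclePartrec f) (hh : OraclePartrec h) :
      OraclePartrec fun o n => (f o n).bind fun a => (h o n).map fun b => Nat.pair a b
  | comp {f h : (ℕ → Bool) → ℕ →. ℕ} (hf : OraclePartrec f) (hh : OraclePartrec h) :
      OraclePartrec fun o n => (h o n).bind (f o)
  | prec {f h : (ℕ → Bool) → ℕ →. ℕ} (hf : OraclePartrec f) (hh : OraclePartrec h) :
      OraclePartrec fun o p =>
        Nat.rec (motive := fun _ => Part ℕ) (f o p.unpair.1)
          (fun y ih => ih.bind fun i => h o (Nat.pair p.unpair.1 (Nat.pair y i))) p.unpair.2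
  | rfind {f : (ℕ → Bool) → ℕ →. ℕ} (hf : OraclePartrec f) :
      OraclePartrec fun o a =>
        Nat.rfind fun n => (f o (Nat.pair a n)).map fun m => decide (m = 0)

/-- A partial function of a finite and an infinite binary sequence, with values in the finite binary
sequences, is computable: one algorithm computes it from its first argument with its second one as
oracle. (Being partial, it may be undefined at some arguments; the algorithm runs forever there.) -/
def IsComputable (φ : List Bool → (ℕ → Bool) → Part (List Bool)) : Prop :=
  OraclePartrec fun o n =>
    (Part.ofOption (Encodable.decode (α := List Bool) n)).bind fun x =>
      (φ x o).map Encodable.encode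

/-- The self-delimiting pairing `⟨x, y⟩ = 1 ^ |x| 0 x y` of finite binary sequences. -/
def pairing (x y : List Bool) : List Bool :=
  List.replicate x.length true ++ false :: (x ++ y)

/-- `U` is a universal computable function: it is computable and for every computable `φ` there is
a program `p` with `φ (x, o) = U (⟨p, x⟩, o)` for all `x` and `o`. -/
def IsUniversal (U : List Bool → (ℕ → Bool) → Part (List Bool)) : Prop :=
  IsComputable U ∧
    ∀ φ : List Bool → (ℕ → Bool) → Part (List Bool), IsComputable φ →
      ∃ p : List Bool, ∀ (x : List Bool) (o : ℕ → Bool), φ x o = U (pairing p x) o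

/-! ### Algorithmic complexity -/

/-- The algorithmic complexity `K_U[x | o]` of `x` relative to the sequence `o`: the least length of
a finite binary sequence `w` with `U (w, o) = x`. -/
def complexity (U : List Bool → (ℕ → Bool) → Part (List Bool)) (x : List Bool)
    (o : ℕ → Bool) : ℕ :=
  sInf {l : ℕ | ∃ w : List Bool, w.length = l ∧ x ∈ U w o}

/-- The algorithmic complexity `K_U[x | β]` of `x` relative to the base `β`, which is presented by
the greedy binary expansion of `β - 1`. -/
def baseComplexity (U : List Bool → (ℕ → Bool) → Part (List Bool)) (x : List Bool)
    (β : ℝ) : ℕ :=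
  complexity U x (greedyExpansion 2 (β - 1))

/-- The prefix of length `n` of an infinite binary sequence. -/
def firstDigits (x : ℕ → Bool) (n : ℕ) : List Bool :=
  List.ofFn fun i : Fin n => x i

/-- `n(β) = ⌈n log_β 2⌉`, the number of digits in base `β` that are compared with `n` binary
digits. -/
def digitCount (β : ℝ) (n : ℕ) : ℕ :=
  ⌈(n : ℝ) * Real.logb β 2⌉₊

/-- The quotient `(K[x_{1:n(β)} | β] - K[y_{1:n} | β]) / n`, where `y` is the greedy binary
expansion of the number that `x` represents in base `β`. -/
def complexityGap (U : List Bool → (ℕ → Bool) → Part (List Bool)) (β : ℝ) (x : ℕ → Bool)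
    (n : ℕ) : ℝ :=
  ((baseComplexity U (firstDigits x (digitCount β n)) β : ℝ)
    - (baseComplexity U (firstDigits (greedyExpansion 2 (value β x)) n) β : ℝ)) / n

/-- The lower relative compressibility of `x`, a limit inferior in the extended reals. -/
def lowerDelta (U : List Bool → (ℕ → Bool) → Part (List Bool)) (β : ℝ) (x : ℕ → Bool) : EReal :=
  Filter.liminf (fun n : ℕ => (complexityGap U β x n : EReal)) Filter.atTop

/-- The upper relative compressibility of `x`, a limit superior in the extended reals. -/
def upperDelta (U : List Bool → (ℕ → Bool) → Part (List Bool)) (β : ℝ) (x : ℕ → Bool) : EReal :=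
  Filter.limsup (fun n : ℕ => (complexityGap U β x n : EReal)) Filter.atTop

end BetaExpansion

end

noncomputable section
namespace BetaExpansion

/-! ### Functions computed with an oracle -/

/-! Put m = n(β), so that 2^n ≤ β^m ≤ 2·2^n. Read as an integer, the binary prefix `Y` of length n
equals 2^n s up to an error in [0, 1]. The greedy prefix of length m, read in base β with
nonnegative powers (`digitSum`), equals β^m s up to an error in [0, 1/(β-1)]. Rescaling therefore
turns either number into an estimate of the other with error bounded independently of n and s, and
it remains to name the true value near the estimate.

From base β to base 2 the target is an integer, so a bounded correction determines it
(`exists_baseComplexity_binary_le`). In the other direction the Pisot property enters through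
Garsia's separation lemma (`IsPisot.exists_le_abs_aeval`): distinct values of words of equal length
differ by at least some c > 0 independent of the length. Hence a bounded correction determines the
value of the word. Many words may share that value; the greedy prefix is the lexicographically
largest of them (`le_prefixNat_of_digitSum_eq`), and a search finds it
(`exists_baseComplexity_expansion_le`).

The decoders do exact integer arithmetic with a rational approximation of β whose numerator is read
from the oracle. Apart from the given prefix they need only the lengths, the precision and the
correction, which is O(log n) bits of advice (`exists_complexity_le_add`). So the two complexities
differ by O(log n), and the quotient by n tends to 0. -/

theorem OraclePartrec.of_eq {f g : (ℕ → Bool) → ℕ →. ℕ} (hf : OraclePartrec f)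
    (h : ∀ o n, f o n = g o n) : OraclePartrec g :=
  (funext fun o => funext (h o) : f = g) ▸ hf

theorem OraclePartrec.of_partrec {f : ℕ →. ℕ} (hf : Nat.Partrec f) :
    OraclePartrec fun _ => f := by
  induction hf with
  | zero => exact OraclePartrec.zero
  | succ => exact OraclePartrec.succ
  | left => exact OraclePartrec.left
  | right => exact OraclePartrec.right
  | @pair f g _ _ hf hg =>
    convert OraclePartrec.pair hf hg using 3
    simp [Seq.seq, Part.bind_map]
  | comp _ _ hf hg => exact OraclePartrec.comp hf hg
  | prec _ _ hf hg => exact OraclePartrec.prec hf hg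
  | rfind _ hf => exact OraclePartrec.rfind hf

/-- Computability of a partial function between encodable types relative to all oracles. -/
def OracleComputable {α γ : Type*} [Primcodable α] [Primcodable γ]
    (F : α → (ℕ → Bool) → Part γ) : Prop :=
  OraclePartrec fun o n =>
    (Part.ofOption (Encodable.decode (α := α) n)).bind fun a => (F a o).map Encodable.encode

namespace OracleComputable

variable {α γ δ : Type*} [Primcodable α] [Primcodable γ] [Primcodable δ]

theorem of_partrec {f : α →. γ} (hf : Partrec f) : OracleComputable fun a _ => f a :=
  OraclePartrec.of_partrec hf

theorem of_computable {f : α → γ} (hf : Computable f) :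
    OracleComputable fun a _ => Part.some (f a) :=
  of_partrec hf.partrec

theorem comp {F : γ → (ℕ → Bool) → Part δ} {G : α → (ℕ → Bool) → Part γ}
    (hF : OracleComputable F) (hG : OracleComputable G) :
    OracleComputable fun a o => (G a o).bind fun b => F b o := by
  refine (OraclePartrec.comp hF hG).of_eq fun o n => ?_
  rw [Part.bind_assoc]
  congr 1
  funext a
  simp [Part.bind_map, Part.map_bind]

theorem pair {F : α → (ℕ → Bool) → Part γ} {G : α → (ℕ → Bool) → Part δ}
    (hF : OracleComputable F) (hG : OracleComputable G) :
    OracleComputable fun a o => (F a o).bind fun b => (G a o).map fun c => (b, c) := by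
  refine (OraclePartrec.pair hF hG).of_eq fun o n => ?_
  cases Encodable.decode (α := α) n with
  | none => simp
  | some a => simp [Part.bind_map, Part.map_bind, Part.map_map, Function.comp_def]

end OracleComputable

/-! ### Binary words coded as natural numbers -/

/-- The number with the binary digits `x 0, …, x (n - 1)`, the first one being the most
significant. -/
def prefixNat (x : ℕ → Bool) : ℕ → ℕ
  | 0 => 0
  | n + 1 => 2 * prefixNat x n + (x n).toNat

/-- Primitive recursion on the number of digits, each step querying one digit of the oracle. The
decoding algorithms see the oracle only through this function. -/
theorem oracleComputable_prefixNat :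
    OracleComputable fun (n : ℕ) o => Part.some (prefixNat o n) := by
  have hstep : Nat.Partrec fun p : ℕ =>
      (Part.some (2 * p.unpair.1 + p.unpair.2) : Part ℕ) := by
    have : Computable fun p : ℕ => 2 * p.unpair.1 + p.unpair.2 :=
      (Primrec.nat_add.comp (Primrec.nat_mul.comp (Primrec.const 2)
        (Primrec.fst.comp Primrec.unpair)) (Primrec.snd.comp Primrec.unpair)).to_comp
    exact Partrec.nat_iff.1 this
  have hy : Nat.Partrec fun p : ℕ => (Part.some p.unpair.2.unpair.1 : Part ℕ) :=
    Partrec.nat_iff.1 (Primrec.fst.comp (Primrec.unpair.comp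
      (Primrec.snd.comp Primrec.unpair))).to_comp
  have hi : Nat.Partrec fun p : ℕ => (Part.some p.unpair.2.unpair.2 : Part ℕ) :=
    Partrec.nat_iff.1 (Primrec.snd.comp (Primrec.unpair.comp
      (Primrec.snd.comp Primrec.unpair))).to_comp
  have hin : Nat.Partrec fun n : ℕ => (Part.some (Nat.pair 0 n) : Part ℕ) :=
    Partrec.nat_iff.1 (Primrec₂.natPair.comp (Primrec.const 0) Primrec.id).to_comp
  have hrec := OraclePartrec.comp (OraclePartrec.prec OraclePartrec.zero
    (OraclePartrec.comp (OraclePartrec.of_partrec hstep)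
      (OraclePartrec.pair (OraclePartrec.of_partrec hi)
        (OraclePartrec.comp OraclePartrec.oracle (OraclePartrec.of_partrec hy)))))
    (OraclePartrec.of_partrec hin)
  refine hrec.of_eq fun o n => ?_
  simp only [Encodable.decode_nat, Part.coe_some, Part.bind_some, Part.map_some,
    Encodable.encode_nat, Nat.unpair_pair]
  induction n with
  | zero => rfl
  | succ n ih => simp only [ih]; simp [prefixNat]

/-- The number with the binary digits `l`. -/
def listNat (l : List Bool) : ℕ :=
  l.foldl (fun a b => 2 * a + b.toNat) 0

/-- The binary digits of `N` at the places `m - 1, …, 0`. -/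
def natDigits (N : ℕ) : ℕ → List Bool
  | 0 => []
  | m + 1 => decide (N / 2 ^ m % 2 = 1) :: natDigits N m

theorem length_natDigits (N m : ℕ) : (natDigits N m).length = m := by
  induction m with
  | zero => rfl
  | succ m ih => simp [natDigits, ih]

/-- `natDigits` is defined by splitting off the leading digit, while prefixes grow at the trailing
end; this identity reconciles the two recursions. -/
theorem natDigits_succ' (N m : ℕ) :
    natDigits N (m + 1) = natDigits (N / 2) m ++ [decide (N % 2 = 1)] := by
  induction m with
  | zero => simp [natDigits]
  | succ m ih =>
    rw [natDigits, ih, natDigits, List.cons_append, Nat.div_div_eq_div_mul, pow_succ']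

theorem firstDigits_succ (x : ℕ → Bool) (n : ℕ) :
    firstDigits x (n + 1) = firstDigits x n ++ [x n] := by
  rw [firstDigits, List.ofFn_succ_last]
  rfl

theorem listNat_append_singleton (l : List Bool) (b : Bool) :
    listNat (l ++ [b]) = 2 * listNat l + b.toNat := by
  simp [listNat]

theorem listNat_firstDigits (x : ℕ → Bool) (n : ℕ) :
    listNat (firstDigits x n) = prefixNat x n := by
  induction n with
  | zero => rfl
  | succ n ih => rw [firstDigits_succ, listNat_append_singleton, ih, prefixNat]

theorem natDigits_prefixNat (x : ℕ → Bool) (n : ℕ) :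
    natDigits (prefixNat x n) n = firstDigits x n := by
  induction n with
  | zero => rfl
  | succ n ih =>
    rw [firstDigits_succ, natDigits_succ', prefixNat]
    cases h : x n
    · simp [ih]
    · rw [show (2 * prefixNat x n + true.toNat) / 2 = prefixNat x n by simp; omega, ih]
      simp

theorem listNat_natDigits {a s : ℕ} (h : a < 2 ^ s) : listNat (natDigits a s) = a := by
  induction s generalizing a with
  | zero => simp at h; subst h; rfl
  | succ s ih =>
    rw [natDigits_succ', listNat_append_singleton, ih (by rw [pow_succ] at h; omega)]
    rcases Nat.mod_two_eq_zero_or_one a with h | h <;> simp [h] <;> omega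

theorem primrec_boolToNat : Primrec Bool.toNat := Primrec.dom_bool _

theorem primrec_pow : Primrec₂ fun a b : ℕ => a ^ b :=
  Primrec₂.unpaired'.1 Nat.Primrec.pow

theorem primrec_listNat : Primrec listNat := by
  unfold listNat
  exact Primrec.list_foldl Primrec.id (Primrec.const 0)
    (Primrec.nat_add.comp (Primrec.nat_mul.comp (Primrec.const 2)
      (Primrec.fst.comp Primrec.snd))
      (primrec_boolToNat.comp (Primrec.snd.comp Primrec.snd))).to₂

theorem primrec_binaryDigit : Primrec₂ fun N m : ℕ => N / 2 ^ m % 2 :=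
  (Primrec.nat_mod.comp (Primrec.nat_div.comp Primrec.fst
    (primrec_pow.comp (Primrec.const 2) Primrec.snd)) (Primrec.const 2)).to₂

theorem primrec_natDigits : Primrec₂ natDigits := by
  have h : Primrec₂ fun (N : ℕ) (p : ℕ × List Bool) =>
      decide (N / 2 ^ p.1 % 2 = 1) :: p.2 :=
    (Primrec.list_cons.comp
      (PrimrecPred.decide (Primrec.eq.comp (primrec_binaryDigit.comp Primrec.fst
        (Primrec.fst.comp Primrec.snd)) (Primrec.const 1)))
      (Primrec.snd.comp Primrec.snd)).to₂
  refine (Primrec.nat_rec (Primrec.const ([] : List Bool)) h).of_eq fun N m => ?_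
  induction m with
  | zero => rfl
  | succ m ih => simp only [ih, natDigits]

/-- The two components of a sequence of the form `pairing x y`. -/
def unpairing (u : List Bool) : List Bool × List Bool :=
  ((u.drop (u.idxOf false + 1)).take (u.idxOf false),
    (u.drop (u.idxOf false + 1)).drop (u.idxOf false))

theorem unpairing_pairing (x y : List Bool) : unpairing (pairing x y) = (x, y) := by
  have h : (pairing x y).idxOf false = x.length := by
    rw [pairing, List.idxOf_append_of_notMem (by simp)]
    simp
  have hd : (pairing x y).drop (x.length + 1) = x ++ y := by
    rw [pairing, ← List.drop_drop, List.drop_left' (by simp)]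
    simp
  simp [unpairing, h, hd]

theorem length_pairing (x y : List Bool) :
    (pairing x y).length = 2 * x.length + 1 + y.length := by
  simp [pairing]; omega

theorem primrec_unpairing : Primrec unpairing := by
  have hi : Primrec fun u : List Bool => u.idxOf false :=
    Primrec.list_idxOf.comp (Primrec.const false) Primrec.id
  have hd : Primrec fun u : List Bool => u.drop (u.idxOf false + 1) :=
    Primrec.list_drop.comp (Primrec.succ.comp hi) Primrec.id
  exact Primrec.pair (Primrec.list_take.comp hi hd) (Primrec.list_drop.comp hi hd)

/-! ### Complexity with advice -/

theorem exists_program {U : List Bool → (ℕ → Bool) → Part (List Bool)} (hU : IsUniversal U)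
    -- A program for the identity map shows that the set of lengths is nonempty, so the infimum is
    -- attained and is not the default value 0.
    (x : List Bool) (o : ℕ → Bool) : ∃ w, w.length = complexity U x o ∧ x ∈ U w o := by
  obtain ⟨p, hp⟩ := hU.2 (fun x _ => Part.some x) (OracleComputable.of_computable Computable.id)
  exact Nat.sInf_mem (s := {l : ℕ | ∃ w : List Bool, w.length = l ∧ x ∈ U w o})
    ⟨_, pairing p x, rfl, by rw [← hp]; simp⟩

theorem complexity_le {U : List Bool → (ℕ → Bool) → Part (List Bool)} {x w : List Bool}
    {o : ℕ → Bool} (h : x ∈ U w o) : complexity U x o ≤ w.length :=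
  Nat.sInf_le ⟨w, rfl, h⟩

/-- The output of an algorithm that reads a sequence `v`, an advice `a`, and the first
`a.unpair.1` digits of the oracle is at most as complex as `v`, up to twice the length of the
advice and a constant. -/
theorem exists_complexity_le_add {U : List Bool → (ℕ → Bool) → Part (List Bool)}
    (hU : IsUniversal U) {f : (ℕ × ℕ) × List Bool → List Bool} (hf : Computable f) :
    ∃ C : ℕ, ∀ (o : ℕ → Bool) (a s : ℕ) (v : List Bool), a < 2 ^ s →
      complexity U (f ((a, prefixNat o a.unpair.1), v)) o ≤ complexity U v o + 2 * s + C := by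
  have hadv : Computable fun u : List Bool => listNat (unpairing u).1 :=
    (primrec_listNat.comp (Primrec.fst.comp primrec_unpairing)).to_comp
  have hk : Computable fun u : List Bool => (listNat (unpairing u).1).unpair.1 :=
    Computable.fst.comp (Computable.unpair.comp hadv)
  have hw : Computable fun u : List Bool => (unpairing u).2 :=
    (Primrec.snd.comp primrec_unpairing).to_comp
  -- For `List Bool` both notions of computability unfold to the same statement.
  have hU1 : OracleComputable U := hU.1
  have hφ := (OracleComputable.of_computable hf).comp
    (((OracleComputable.of_computable hadv).pair
      (oracleComputable_prefixNat.comp (OracleComputable.of_computable hk))).pair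
      (hU1.comp (OracleComputable.of_computable hw)))
  obtain ⟨p, hp⟩ := hU.2 _ hφ
  -- Two nested pairings: `p` costs 2|p| + 1 bits and the advice 2s + 1, while the program for `v`
  -- comes last and costs only its length.
  refine ⟨2 * p.length + 2, fun o a s v has => ?_⟩
  obtain ⟨w, hwl, hwv⟩ := exists_program hU v o
  have hmem : f ((a, prefixNat o a.unpair.1), v) ∈
      U (pairing p (pairing (natDigits a s) w)) o := by
    rw [← hp]
    simp only [unpairing_pairing, listNat_natDigits has, Part.bind_some, Part.map_some,
      Part.mem_bind_iff, Part.mem_map_iff]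
    exact ⟨_, ⟨v, hwv, rfl⟩, by simp⟩
  refine (complexity_le hmem).trans ?_
  rw [length_pairing, length_pairing, length_natDigits, hwl]
  omega

/-! ### Separation of polynomial values at a Pisot number -/

open Polynomial IntermediateField in
/-- The values at a Pisot number of integer polynomials with coefficients of absolute value at
most `1` are either zero or bounded away from zero. -/
theorem IsPisot.exists_le_abs_aeval {β : ℝ} (hβ : IsPisot β) :
    ∃ c : ℝ, 0 < c ∧ ∀ P : ℤ[X], (∀ i, |P.coeff i| ≤ 1) → aeval β P ≠ 0 → c ≤ |aeval β P| := by
  classical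
  obtain ⟨hint, h1, hconj⟩ := hβ
  have hintQ : IsIntegral ℚ β := hint.tower_top
  have : FiniteDimensional ℚ ℚ⟮β⟯ := adjoin.finiteDimensional hintQ
  let g : ℚ⟮β⟯ := AdjoinSimple.gen ℚ β
  let ι : ℚ⟮β⟯ →ₐ[ℚ] ℂ := ((Complex.ofRealAm.restrictScalars ℚ).comp (val ℚ⟮β⟯))
  have hι : ι g = (β : ℂ) := rfl
  -- An embedding is determined by the image of the generator, so any embedding other than `ι` sends
  -- it to a conjugate different from β.
  have hlt : ∀ σ : ℚ⟮β⟯ →ₐ[ℚ] ℂ, σ ≠ ι → ‖σ g‖ < 1 := by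
    intro σ hσ
    refine hconj _ ?_ fun h => hσ ?_
    · have : aeval g (minpoly ℚ β) = 0 := by
        have := minpoly.aeval ℚ g
        rwa [show minpoly ℚ g = minpoly ℚ β from minpoly_gen ℚ β] at this
      rw [aeval_algHom_apply, this, map_zero]
    · refine (adjoin.powerBasis hintQ).algHom_ext ?_
      rw [adjoin.powerBasis_gen]
      exact h.trans hι.symm
  -- Coefficients bounded by 1 make the value at a conjugate inside the unit disk at most a
  -- geometric series, whatever the degree.
  have hbound : ∀ σ : ℚ⟮β⟯ →ₐ[ℚ] ℂ, σ ≠ ι → ∀ P : ℤ[X], (∀ i, |P.coeff i| ≤ 1) →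
      ‖σ (aeval g P)‖ ≤ (1 - ‖σ g‖)⁻¹ := by
    intro σ hσ P hP
    have hr := hlt σ hσ
    rw [show σ (aeval g P) = aeval (σ g) P from
      (aeval_algHom_apply (σ.restrictScalars ℤ) g P).symm, aeval_eq_sum_range]
    refine (norm_sum_le _ _).trans ?_
    refine le_trans (Finset.sum_le_sum (g := fun i => ‖σ g‖ ^ i) fun i _ => ?_) ?_
    · rw [zsmul_eq_mul, norm_mul, norm_pow]
      have : ‖((P.coeff i : ℤ) : ℂ)‖ ≤ 1 := by
        rw [Complex.norm_intCast]
        exact_mod_cast hP i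
      simpa using mul_le_mul_of_nonneg_right this (pow_nonneg (norm_nonneg (σ g)) i)
    · exact (Summable.sum_le_tsum _ (fun _ _ => by positivity)
        (summable_geometric_of_lt_one (norm_nonneg _) hr)).trans_eq
        (tsum_geometric_of_lt_one (norm_nonneg _) hr)
  refine ⟨∏ σ ∈ Finset.univ.erase ι, (1 - ‖σ g‖),
    Finset.prod_pos fun σ hσ => by have := hlt σ (Finset.ne_of_mem_erase hσ); linarith,
    fun P hP hne => ?_⟩
  have hgP : ι (aeval g P) = ((aeval β P : ℝ) : ℂ) := by
    rw [show ι (aeval g P) = aeval (ι g) P from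
      (aeval_algHom_apply (ι.restrictScalars ℤ) g P).symm, hι]
    exact (aeval_algebraMap_apply ℂ β P)
  have hgne : aeval g P ≠ 0 := by
    intro h
    rw [h, map_zero] at hgP
    exact hne (by exact_mod_cast hgP.symm)
  have hgint : IsIntegral ℤ g := by
    have : IsIntegral ℤ (algebraMap ℚ⟮β⟯ ℝ g) := by simpa [g] using hint
    exact (isIntegral_algebraMap_iff (algebraMap ℚ⟮β⟯ ℝ).injective).1 this
  have hPint : IsIntegral ℤ (aeval g P) := by
    have := (adjoin_le_integralClosure hgint) (aeval_mem_adjoin_singleton ℤ g (p := P))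
    exact this
  -- The norm of a nonzero algebraic integer is a nonzero integer, so the product of all its
  -- conjugates has absolute value at least 1. All factors except |P(β)| are bounded above, which
  -- bounds |P(β)| below.
  obtain ⟨N, hN⟩ := IsIntegrallyClosed.isIntegral_iff.1 (Algebra.isIntegral_norm ℚ hPint)
  have hNne : N ≠ 0 := by
    rintro rfl
    rw [map_zero] at hN
    exact hgne (Algebra.norm_eq_zero_iff.1 hN.symm)
  have hprod := Algebra.norm_eq_prod_embeddings ℚ ℂ (aeval g P)
  rw [← hN] at hprod
  have hnorm : (1 : ℝ) ≤ ∏ σ : ℚ⟮β⟯ →ₐ[ℚ] ℂ, ‖σ (aeval g P)‖ := by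
    rw [← norm_prod, ← hprod]
    simp only [eq_intCast, map_intCast, Complex.norm_intCast]
    exact_mod_cast Int.one_le_abs hNne
  rw [← Finset.mul_prod_erase _ _ (Finset.mem_univ ι), hgP, Complex.norm_real,
    Real.norm_eq_abs] at hnorm
  have hle : ∏ σ ∈ Finset.univ.erase ι, ‖σ (aeval g P)‖
      ≤ (∏ σ ∈ Finset.univ.erase ι, (1 - ‖σ g‖))⁻¹ := by
    rw [← Finset.prod_inv_distrib]
    exact Finset.prod_le_prod (fun _ _ => norm_nonneg _)
      fun σ hσ => hbound σ (Finset.ne_of_mem_erase hσ) P hP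
  have hpos : 0 < ∏ σ ∈ Finset.univ.erase ι, (1 - ‖σ g‖) :=
    Finset.prod_pos fun σ hσ => by have := hlt σ (Finset.ne_of_mem_erase hσ); linarith
  have := hnorm.trans (mul_le_mul_of_nonneg_left hle (abs_nonneg _))
  rwa [← div_eq_mul_inv, one_le_div hpos] at this

/-! ### Values of words in a real base -/

/-- The value in base `γ` of the word formed by the `m` lowest binary digits of `N`. -/
def digitSum (γ : ℝ) (N m : ℕ) : ℝ :=
  ∑ i ∈ Finset.range m, ((N / 2 ^ i % 2 : ℕ) : ℝ) * γ ^ i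

/-- The natural number `Q ^ m * digitSum (B / Q) N m`. -/
def scaledDigitSum (B Q N : ℕ) : ℕ → ℕ
  | 0 => 0
  | m + 1 => Q * (scaledDigitSum B Q N m + N / 2 ^ m % 2 * B ^ m)

theorem scaledDigitSum_eq {B Q : ℕ} (hQ : 0 < Q) (N m : ℕ) :
    (scaledDigitSum B Q N m : ℝ) = (Q : ℝ) ^ m * digitSum (B / Q) N m := by
  have hQ' : (Q : ℝ) ≠ 0 := by positivity
  induction m with
  | zero => simp [scaledDigitSum, digitSum]
  | succ m ih =>
    rw [scaledDigitSum, Nat.cast_mul, Nat.cast_add, ih, digitSum, digitSum,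
      Finset.sum_range_succ]
    push_cast
    rw [div_pow]
    field_simp
    ring

/-- Horner's rule: appending a digit to a word multiplies its value by γ and adds the digit. -/
theorem digitSum_succ' (γ : ℝ) (N m : ℕ) :
    digitSum γ N (m + 1) = γ * digitSum γ (N / 2) m + (N % 2 : ℕ) := by
  rw [digitSum, Finset.sum_range_succ', digitSum, Finset.mul_sum]
  congr 1
  · refine Finset.sum_congr rfl fun i _ => ?_
    rw [Nat.div_div_eq_div_mul, pow_succ' 2 i]
    ring
  · simp

/-- The crude factor 4^i suffices: it only forces the decoders to read about two oracle digits per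
digit in base β. -/
theorem pow_sub_pow_mem {t β q : ℝ} (ht : 0 ≤ t) (htβ : t ≤ β) (hβ : β ≤ 2) (hq : β - t ≤ q)
    (i : ℕ) : β ^ i - t ^ i ∈ Set.Icc 0 (4 ^ i * q) := by
  have hq0 : 0 ≤ q := by linarith
  refine ⟨sub_nonneg.2 (pow_le_pow_left₀ ht htβ i), ?_⟩
  induction i with
  | zero => simpa using hq0
  | succ i ih =>
    have h0 : 0 ≤ β ^ i - t ^ i := sub_nonneg.2 (pow_le_pow_left₀ ht htβ i)
    have h1 : t ^ i ≤ 4 ^ i := pow_le_pow_left₀ ht (by linarith) i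
    have h2 : β * (β ^ i - t ^ i) ≤ 2 * (4 ^ i * q) := mul_le_mul hβ ih h0 (by norm_num)
    have h3 : t ^ i * (β - t) ≤ 4 ^ i * q :=
      mul_le_mul h1 hq (by linarith) (by positivity)
    have h4 : 0 ≤ (4 : ℝ) ^ i * q := by positivity
    calc β ^ (i + 1) - t ^ (i + 1) = β * (β ^ i - t ^ i) + t ^ i * (β - t) := by ring
      _ ≤ 4 ^ (i + 1) * q := by rw [pow_succ]; linarith

theorem digitSum_sub_mem {t β q : ℝ} (ht : 0 ≤ t) (htβ : t ≤ β) (hβ : β ≤ 2) (hq : β - t ≤ q)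
    (N m : ℕ) : digitSum β N m - digitSum t N m ∈ Set.Icc 0 (4 ^ m * q) := by
  have hq0 : 0 ≤ q := by linarith
  have hterm : ∀ i, ((N / 2 ^ i % 2 : ℕ) : ℝ) * (β ^ i - t ^ i) ∈ Set.Icc 0 (4 ^ i * q) := by
    intro i
    obtain ⟨h0, h1⟩ := pow_sub_pow_mem ht htβ hβ hq i
    rcases Nat.mod_two_eq_zero_or_one (N / 2 ^ i) with h | h <;> rw [h]
    · simpa using hq0
    · simpa using ⟨sub_nonneg.1 h0, sub_le_iff_le_add.1 h1⟩
  induction m with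
  | zero => simpa [digitSum] using hq0
  | succ m ih =>
    have heq : digitSum β N (m + 1) - digitSum t N (m + 1) = (digitSum β N m - digitSum t N m)
        + ((N / 2 ^ m % 2 : ℕ) : ℝ) * (β ^ m - t ^ m) := by
      rw [digitSum, Finset.sum_range_succ, digitSum, Finset.sum_range_succ, digitSum, digitSum]
      ring
    have h4 : 0 ≤ (4 : ℝ) ^ m * q := by positivity
    rw [heq, pow_succ]
    exact ⟨add_nonneg ih.1 (hterm m).1, by linarith [ih.2, (hterm m).2]⟩

-- The digitwise difference of two binary words is a polynomial with coefficients in {-1, 0, 1}, so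
-- Garsia's bound applies with a constant independent of the length.
open Polynomial in
theorem IsPisot.exists_le_abs_digitSum_sub {β : ℝ} (hβ : IsPisot β) :
    ∃ c : ℝ, 0 < c ∧ ∀ N N' m : ℕ, digitSum β N m ≠ digitSum β N' m →
      c ≤ |digitSum β N m - digitSum β N' m| := by
  obtain ⟨c, hc, h⟩ := hβ.exists_le_abs_aeval
  refine ⟨c, hc, fun N N' m hne => ?_⟩
  let P : ℤ[X] := ∑ i ∈ Finset.range m,
    C (((N / 2 ^ i % 2 : ℕ) : ℤ) - ((N' / 2 ^ i % 2 : ℕ) : ℤ)) * X ^ i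
  have hP : aeval β P = digitSum β N m - digitSum β N' m := by
    simp only [P, map_sum, map_mul, map_pow, aeval_X, aeval_C, digitSum]
    rw [← Finset.sum_sub_distrib]
    refine Finset.sum_congr rfl fun i _ => ?_
    simp only [eq_intCast, Int.cast_sub, Int.cast_natCast]
    ring
  rw [← hP]
  refine h P (fun i => ?_) (by rw [hP]; exact sub_ne_zero.2 hne)
  simp only [P, finsetSum_coeff, coeff_C_mul_X_pow, Finset.sum_ite_eq]
  split_ifs
  · rw [abs_le]; omega
  · simp

/-- The invariant of the greedy algorithm. Since the remainder is bounded, the value of the prefix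
is within a constant of β^m s. -/
theorem digitSum_prefixNat_add_greedyRemainder (β s : ℝ) (m : ℕ) :
    digitSum β (prefixNat (greedyExpansion β s) m) m + greedyRemainder β s m = β ^ m * s := by
  induction m with
  | zero => simp [digitSum, greedyRemainder]
  | succ m ih =>
    rw [digitSum_succ', greedyRemainder_succ, prefixNat, pow_succ', mul_assoc, ← ih]
    cases greedyExpansion β s m
    · simp; ring
    · rw [show (2 * prefixNat (greedyExpansion β s) m + true.toNat) / 2
        = prefixNat (greedyExpansion β s) m by simp; omega]
      simp; ring

theorem prefixNat_add_greedyRemainder (s : ℝ) (n : ℕ) :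
    prefixNat (greedyExpansion 2 s) n + greedyRemainder 2 s n = 2 ^ n * s := by
  induction n with
  | zero => simp [prefixNat, greedyRemainder]
  | succ n ih =>
    rw [greedyRemainder_succ, prefixNat, pow_succ', mul_assoc, ← ih]
    push_cast
    ring

theorem prefixNat_lt (x : ℕ → Bool) (n : ℕ) : prefixNat x n < 2 ^ n := by
  induction n with
  | zero => simp [prefixNat]
  | succ n ih =>
    have := Bool.toNat_lt (x n)
    rw [prefixNat, pow_succ]
    omega

/-- The greedy digit is 0 only if a 1 would overshoot. A lexicographically larger word has a 1 at
the first place of disagreement, and nonnegative later digits cannot repair the excess. -/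
theorem lt_digitSum_of_prefixNat_lt {β s : ℝ} (h1 : 1 < β) {N m : ℕ} (hN : N < 2 ^ m)
    (h : prefixNat (greedyExpansion β s) m < N) : β ^ m * s < digitSum β N m := by
  have hb : 0 < β := by linarith
  induction m generalizing N with
  | zero => simp at hN; omega
  | succ m ih =>
    rw [prefixNat] at h
    rw [digitSum_succ']
    rcases lt_or_eq_of_le (show prefixNat (greedyExpansion β s) m ≤ N / 2 by omega) with hlt | heq
    · have := mul_lt_mul_of_pos_left (ih (by rw [pow_succ] at hN; omega) hlt) hb
      rw [pow_succ', mul_assoc]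
      have h0 : (0 : ℝ) ≤ (N % 2 : ℕ) := by positivity
      linarith
    · cases hg : greedyExpansion β s m
      · have hN2 : N % 2 = 1 := by
          rw [hg] at h
          simp at h
          omega
        have hr : greedyRemainder β s m < β⁻¹ := by simpa [greedyExpansion] using hg
        have hr' : β * greedyRemainder β s m < 1 := by
          have := mul_lt_mul_of_pos_left hr hb
          rwa [mul_inv_cancel₀ hb.ne'] at this
        rw [← heq, hN2, pow_succ', mul_assoc, ← digitSum_prefixNat_add_greedyRemainder]
        push_cast
        linarith
      · rw [hg] at h
        simp at h
        omega

theorem le_prefixNat_of_digitSum_eq {β s : ℝ} (h1 : 1 < β) (h2 : β ≤ 2)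
    (hs : s ∈ Set.Icc 0 (1 / (β - 1))) {N m : ℕ} (hN : N < 2 ^ m)
    (h : digitSum β N m = digitSum β (prefixNat (greedyExpansion β s) m) m) :
    N ≤ prefixNat (greedyExpansion β s) m := by
  by_contra hlt
  have := lt_digitSum_of_prefixNat_lt h1 hN (not_le.1 hlt)
  rw [h, ← digitSum_prefixNat_add_greedyRemainder] at this
  linarith [(greedyRemainder_mem h1 h2 hs m).1]

/-! ### The decoding algorithms -/

/-- The word of length `m` with the largest index among those whose value in base `B / Q`, in
units of `1 / D`, is close to the one predicted from `n` binary digits. -/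
def expansionFromBinary (D : ℕ) (p : (ℕ × ℕ) × List Bool) : List Bool :=
  let k := p.1.1.unpair.1
  let n := p.1.1.unpair.2.unpair.1
  let m := p.1.1.unpair.2.unpair.2.unpair.1
  let j := p.1.1.unpair.2.unpair.2.unpair.2.unpair
  let Q := 2 ^ k
  let B := Q + p.1.2
  natDigits (Nat.findGreatest (fun N => scaledDigitSum B Q N m * D / Q ^ m
    = D * B ^ m * listNat p.2 / (Q ^ m * 2 ^ n) + j.2 - j.1) (2 ^ m - 1)) m

/-- The `n` binary digits predicted from a word of length `m` in base `B / Q`. -/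
def binaryFromExpansion (p : (ℕ × ℕ) × List Bool) : List Bool :=
  let k := p.1.1.unpair.1
  let n := p.1.1.unpair.2.unpair.1
  let m := p.1.1.unpair.2.unpair.2.unpair.1
  let j := p.1.1.unpair.2.unpair.2.unpair.2.unpair
  let Q := 2 ^ k
  let B := Q + p.1.2
  natDigits (scaledDigitSum B Q (listNat p.2) m * 2 ^ n / B ^ m + j.2 - j.1) n

section Primrec

variable {α : Type*} [Primcodable α]

theorem primrec_scaledDigitSum {B Q N m : α → ℕ} (hB : Primrec B) (hQ : Primrec Q)
    (hN : Primrec N) (hm : Primrec m) :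
    Primrec fun a => scaledDigitSum (B a) (Q a) (N a) (m a) := by
  have hstep : Primrec₂ fun (a : α) (p : ℕ × ℕ) =>
      Q a * (p.2 + N a / 2 ^ p.1 % 2 * B a ^ p.1) := by
    refine Primrec.nat_mul.comp (hQ.comp Primrec.fst) (Primrec.nat_add.comp
      (Primrec.snd.comp Primrec.snd) (Primrec.nat_mul.comp
        (primrec_binaryDigit.comp (hN.comp Primrec.fst) (Primrec.fst.comp Primrec.snd))
        (primrec_pow.comp (hB.comp Primrec.fst) (Primrec.fst.comp Primrec.snd))))
  refine (Primrec.nat_rec' hm (Primrec.const 0) hstep).of_eq fun a => ?_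
  induction m a with
  | zero => rfl
  | succ m ih => simp only [ih, scaledDigitSum]

theorem computable_expansionFromBinary (D : ℕ) : Computable (expansionFromBinary D) := by
  have ha : Primrec fun p : (ℕ × ℕ) × List Bool => p.1.1 := Primrec.fst.comp Primrec.fst
  have hk := Primrec.fst.comp (Primrec.unpair.comp ha)
  have ha1 := Primrec.unpair.comp (Primrec.snd.comp (Primrec.unpair.comp ha))
  have hn := Primrec.fst.comp ha1
  have ha2 := Primrec.unpair.comp (Primrec.snd.comp ha1)
  have hm := Primrec.fst.comp ha2
  have hj := Primrec.unpair.comp (Primrec.snd.comp ha2)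
  have hQ := primrec_pow.comp (Primrec.const 2) hk
  have hB := Primrec.nat_add.comp hQ (Primrec.snd.comp Primrec.fst)
  have hv : Primrec fun p : (ℕ × ℕ) × List Bool => listNat p.2 :=
    primrec_listNat.comp Primrec.snd
  have hQm := primrec_pow.comp hQ hm
  have hest := Primrec.nat_sub.comp (Primrec.nat_add.comp (Primrec.nat_div.comp
    (Primrec.nat_mul.comp (Primrec.nat_mul.comp (Primrec.const D) (primrec_pow.comp hB hm)) hv)
    (Primrec.nat_mul.comp hQm (primrec_pow.comp (Primrec.const 2) hn)))
    (Primrec.snd.comp hj)) (Primrec.fst.comp hj)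
  have hcell := Primrec.nat_div.comp (Primrec.nat_mul.comp
    (primrec_scaledDigitSum (hB.comp Primrec.fst) (hQ.comp Primrec.fst)
      (Primrec.snd (α := (ℕ × ℕ) × List Bool) (β := ℕ)) (hm.comp Primrec.fst))
    (Primrec.const D)) (hQm.comp Primrec.fst)
  have hbound := Primrec.nat_sub.comp (primrec_pow.comp (Primrec.const 2) hm) (Primrec.const 1)
  have hrel : PrimrecRel fun (p : (ℕ × ℕ) × List Bool) (N : ℕ) =>
      scaledDigitSum (2 ^ p.1.1.unpair.1 + p.1.2) (2 ^ p.1.1.unpair.1) N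
        p.1.1.unpair.2.unpair.2.unpair.1 * D
          / (2 ^ p.1.1.unpair.1) ^ p.1.1.unpair.2.unpair.2.unpair.1
        = D * (2 ^ p.1.1.unpair.1 + p.1.2) ^ p.1.1.unpair.2.unpair.2.unpair.1 * listNat p.2
            / ((2 ^ p.1.1.unpair.1) ^ p.1.1.unpair.2.unpair.2.unpair.1
              * 2 ^ p.1.1.unpair.2.unpair.1)
          + p.1.1.unpair.2.unpair.2.unpair.2.unpair.2
          - p.1.1.unpair.2.unpair.2.unpair.2.unpair.1 :=
    Primrec.eq.comp hcell (hest.comp Primrec.fst)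
  have hgreatest := Primrec.nat_findGreatest hbound hrel
  exact (primrec_natDigits.comp hgreatest hm).to_comp

theorem computable_binaryFromExpansion : Computable binaryFromExpansion := by
  have ha : Primrec fun p : (ℕ × ℕ) × List Bool => p.1.1 := Primrec.fst.comp Primrec.fst
  have hk := Primrec.fst.comp (Primrec.unpair.comp ha)
  have ha1 := Primrec.unpair.comp (Primrec.snd.comp (Primrec.unpair.comp ha))
  have hn := Primrec.fst.comp ha1
  have ha2 := Primrec.unpair.comp (Primrec.snd.comp ha1)
  have hm := Primrec.fst.comp ha2
  have hj := Primrec.unpair.comp (Primrec.snd.comp ha2)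
  have hQ := primrec_pow.comp (Primrec.const 2) hk
  have hB := Primrec.nat_add.comp hQ (Primrec.snd.comp Primrec.fst)
  have hv : Primrec fun p : (ℕ × ℕ) × List Bool => listNat p.2 :=
    primrec_listNat.comp Primrec.snd
  exact (primrec_natDigits.comp (Primrec.nat_sub.comp (Primrec.nat_add.comp (Primrec.nat_div.comp
    (Primrec.nat_mul.comp (primrec_scaledDigitSum hB hQ hv hm)
      (primrec_pow.comp (Primrec.const 2) hn)) (primrec_pow.comp hB hm))
    (Primrec.snd.comp hj)) (Primrec.fst.comp hj)) hn).to_comp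

end Primrec

/-! ### Accuracy of the predictions -/

theorem abs_natCast_div_sub_le (a b : ℕ) :
    |((a / b : ℕ) : ℝ) - a / b| ≤ 1 := by
  have h1 : ((a / b : ℕ) : ℝ) ≤ a / b := Nat.cast_div_le
  have h2 : (a : ℝ) / b < (a / b : ℕ) + 1 := by
    rw [← Nat.floor_div_eq_div (K := ℝ)]
    exact Nat.lt_floor_add_one _
  rw [abs_le]
  constructor <;> linarith

theorem abs_div_sub_div_lt_one {a a' b : ℕ} (h : a / b = a' / b) :
    |(a : ℝ) / b - a' / b| < 1 := by
  have h1 : ((a / b : ℕ) : ℝ) ≤ a / b := Nat.cast_div_le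
  have h2 : (a : ℝ) / b < (a / b : ℕ) + 1 := by
    rw [← Nat.floor_div_eq_div (K := ℝ)]
    exact Nat.lt_floor_add_one _
  have h3 : ((a' / b : ℕ) : ℝ) ≤ a' / b := Nat.cast_div_le
  have h4 : (a' : ℝ) / b < (a' / b : ℕ) + 1 := by
    rw [← Nat.floor_div_eq_div (K := ℝ)]
    exact Nat.lt_floor_add_one _
  rw [h] at h1 h2
  rw [abs_lt]
  constructor <;> linarith

theorem icc_zero_one_subset {β : ℝ} (hβ : β ∈ Set.Ioo (1 : ℝ) 2) :
    Set.Icc (0 : ℝ) 1 ⊆ Set.Icc 0 (1 / (β - 1)) := by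
  refine Set.Icc_subset_Icc_right ?_
  rw [le_div_iff₀] <;> linarith [hβ.1, hβ.2]

/-- The numerator of the approximation to `β` with denominator `2 ^ k` from below. -/
def baseNumerator (β : ℝ) (k : ℕ) : ℕ :=
  2 ^ k + prefixNat (greedyExpansion 2 (β - 1)) k

theorem greedyRemainder_two_mem {s : ℝ} (hs : s ∈ Set.Icc (0 : ℝ) 1) (n : ℕ) :
    greedyRemainder 2 s n ∈ Set.Icc (0 : ℝ) 1 := by
  have := greedyRemainder_mem (β := 2) (s := s) (by norm_num) le_rfl (by norm_num; exact hs) n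
  norm_num at this
  exact this

/-- The precision k = 2m + e is chosen so that 4^m · 2^(-k) = 2^(-e), which bounds the error in the
value of every word of length m at once. -/
theorem exists_baseApproximation {β : ℝ} (hβ : β ∈ Set.Ioo (1 : ℝ) 2) (e m : ℕ) :
    ∃ t : ℝ, (baseNumerator β (2 * m + e) : ℝ) / ((2 ^ (2 * m + e) : ℕ) : ℝ) = t ∧ 1 ≤ t ∧
      t ^ m ≤ β ^ m ∧ β ^ m - t ^ m ≤ 1 / 2 ^ e ∧
      ∀ N, digitSum β N m - digitSum t N m ∈ Set.Icc (0 : ℝ) (1 / 2 ^ e) := by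
  set k := 2 * m + e with hk
  have hr := greedyRemainder_two_mem (s := β - 1) ⟨by linarith [hβ.1], by linarith [hβ.2]⟩ k
  have heq := prefixNat_add_greedyRemainder (β - 1) k
  have hp : (0 : ℝ) < 2 ^ k := by positivity
  have ht : (baseNumerator β k : ℝ) / ((2 ^ k : ℕ) : ℝ)
      = β - greedyRemainder 2 (β - 1) k / 2 ^ k := by
    rw [baseNumerator]
    push_cast
    rw [div_eq_iff hp.ne', sub_mul, div_mul_cancel₀ _ hp.ne']
    linarith
  have ht1 : 1 ≤ (baseNumerator β k : ℝ) / ((2 ^ k : ℕ) : ℝ) := by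
    rw [one_le_div (by positivity), baseNumerator]
    exact_mod_cast Nat.le_add_right _ _
  have htβ : (baseNumerator β k : ℝ) / ((2 ^ k : ℕ) : ℝ) ≤ β := by
    rw [ht]
    have := div_nonneg hr.1 hp.le
    linarith
  have hq : β - (baseNumerator β k : ℝ) / ((2 ^ k : ℕ) : ℝ) ≤ 1 / 2 ^ k := by
    rw [ht, sub_sub_cancel]
    exact div_le_div_of_nonneg_right hr.2 hp.le
  have hε : (4 : ℝ) ^ m * (1 / 2 ^ k) = 1 / 2 ^ e := by
    rw [hk, pow_add, pow_mul]
    norm_num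
    field_simp
  refine ⟨_, rfl, ht1, ?_, ?_, fun N => ?_⟩
  · exact pow_le_pow_left₀ (by linarith) htβ m
  · rw [← hε]
    exact (pow_sub_pow_mem (by linarith) htβ hβ.2.le hq m).2
  · rw [← hε]
    exact digitSum_sub_mem (by linarith) htβ hβ.2.le hq N m

theorem baseNumerator_pos (β : ℝ) (k : ℕ) : 0 < baseNumerator β k := by
  rw [baseNumerator]; positivity

variable {β s : ℝ} {n m : ℕ}

theorem abs_expansion_prediction_sub_le (hβ : β ∈ Set.Ioo (1 : ℝ) 2) (hs : s ∈ Set.Icc (0 : ℝ) 1)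
    (hm : β ^ m ≤ 2 * 2 ^ n) (e : ℕ) :
    |((scaledDigitSum (baseNumerator β (2 * m + e)) (2 ^ (2 * m + e))
          (prefixNat (greedyExpansion β s) m) m * 2 ^ e / (2 ^ (2 * m + e)) ^ m : ℕ) : ℝ)
      - ((2 ^ e * baseNumerator β (2 * m + e) ^ m * prefixNat (greedyExpansion 2 s) n
          / ((2 ^ (2 * m + e)) ^ m * 2 ^ n) : ℕ) : ℝ)| ≤ 2 ^ e * (1 / (β - 1) + 4) + 2 := by
  obtain ⟨t, ht, ht1, hle, hsub, hX⟩ := exists_baseApproximation hβ e m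
  generalize hB : baseNumerator β (2 * m + e) = B at *
  have hQpos : 0 < 2 ^ (2 * m + e) := by positivity
  generalize hQ : 2 ^ (2 * m + e) = Q at *
  have hQ' : (0 : ℝ) < Q := by exact_mod_cast hQpos
  have hr := greedyRemainder_mem hβ.1 hβ.2.le (icc_zero_one_subset hβ hs) m
  have hr' := greedyRemainder_two_mem hs n
  have hXs := digitSum_prefixNat_add_greedyRemainder β s m
  have hY := prefixNat_add_greedyRemainder s n
  have hS := scaledDigitSum_eq (B := B) hQpos (prefixNat (greedyExpansion β s) m) m
  have hXt := hX (prefixNat (greedyExpansion β s) m)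
  have h1 := abs_natCast_div_sub_le (scaledDigitSum B Q (prefixNat (greedyExpansion β s) m) m
    * 2 ^ e) (Q ^ m)
  have h2 := abs_natCast_div_sub_le (2 ^ e * B ^ m * prefixNat (greedyExpansion 2 s) n)
    (Q ^ m * 2 ^ n)
  have e1 : ((scaledDigitSum B Q (prefixNat (greedyExpansion β s) m) m * 2 ^ e : ℕ) : ℝ)
      / ((Q ^ m : ℕ) : ℝ) = 2 ^ e * digitSum t (prefixNat (greedyExpansion β s) m) m := by
    push_cast
    rw [hS, ht]
    field_simp
  have e2 : ((2 ^ e * B ^ m * prefixNat (greedyExpansion 2 s) n : ℕ) : ℝ)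
      / ((Q ^ m * 2 ^ n : ℕ) : ℝ)
        = 2 ^ e * (t ^ m * s - t ^ m / 2 ^ n * greedyRemainder 2 s n) := by
    push_cast
    rw [← ht, div_pow]
    field_simp
    linear_combination (B : ℝ) ^ m * hY
  rw [e1] at h1
  rw [e2] at h2
  have hε : (1 : ℝ) / 2 ^ e ≤ 1 := by
    rw [div_le_one (by positivity)]
    exact one_le_pow₀ (by norm_num)
  have h3 : t ^ m / 2 ^ n * greedyRemainder 2 s n ∈ Set.Icc (0 : ℝ) 2 := by
    have h20 : (0 : ℝ) ≤ t ^ m / 2 ^ n := by positivity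
    have h21 : t ^ m / 2 ^ n ≤ 2 := by
      rw [div_le_iff₀ (by positivity)]
      linarith
    exact ⟨mul_nonneg h20 hr'.1, (mul_le_mul h21 hr'.2 hr'.1 (by norm_num)).trans_eq (by norm_num)⟩
  have h4 : (β ^ m - t ^ m) * s ∈ Set.Icc (0 : ℝ) 1 := by
    have h40 : 0 ≤ β ^ m - t ^ m := by linarith
    exact ⟨mul_nonneg h40 hs.1, (mul_le_mul (hsub.trans hε) hs.2 hs.1 (by norm_num)).trans_eq
      (by norm_num)⟩
  -- The sources of error are the greedy remainder (at most 1/(β-1)), the replacement of β by t in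
  -- the word (1) and in β^m s (1), and the rescaled binary remainder (2). The two integer divisions
  -- account for the final 2 in the statement.
  have h5 : |digitSum t (prefixNat (greedyExpansion β s) m) m
      - (t ^ m * s - t ^ m / 2 ^ n * greedyRemainder 2 s n)| ≤ 1 / (β - 1) + 4 := by
    rw [abs_le]
    constructor <;> linarith [hr.1, hr.2, hXt.1, hXt.2, h3.1, h3.2, h4.1, h4.2]
  have h6 : |2 ^ e * digitSum t (prefixNat (greedyExpansion β s) m) m
      - 2 ^ e * (t ^ m * s - t ^ m / 2 ^ n * greedyRemainder 2 s n)|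
        ≤ 2 ^ e * (1 / (β - 1) + 4) := by
    rw [← mul_sub, abs_mul, abs_of_pos (by positivity : (0 : ℝ) < 2 ^ e)]
    exact mul_le_mul_of_nonneg_left h5 (by positivity)
  rw [abs_le] at h1 h2 h6 ⊢
  constructor <;> linarith [h1.1, h1.2, h2.1, h2.2, h6.1, h6.2]

theorem abs_binary_prediction_sub_le (hβ : β ∈ Set.Ioo (1 : ℝ) 2) (hs : s ∈ Set.Icc (0 : ℝ) 1)
    (hm : 2 ^ n ≤ β ^ m) (e : ℕ) :
    |((prefixNat (greedyExpansion 2 s) n : ℕ) : ℝ)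
      - ((scaledDigitSum (baseNumerator β (2 * m + e)) (2 ^ (2 * m + e))
          (prefixNat (greedyExpansion β s) m) m * 2 ^ n
            / baseNumerator β (2 * m + e) ^ m : ℕ) : ℝ)| ≤ 2 * (1 / (β - 1) + 2) + 2 := by
  obtain ⟨t, ht, ht1, hle, hsub, hX⟩ := exists_baseApproximation hβ e m
  have hBpos := baseNumerator_pos β (2 * m + e)
  generalize hB : baseNumerator β (2 * m + e) = B at *
  have hQpos : 0 < 2 ^ (2 * m + e) := by positivity
  generalize hQ : 2 ^ (2 * m + e) = Q at *
  have hQ' : (0 : ℝ) < Q := by exact_mod_cast hQpos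
  have hB' : (0 : ℝ) < B := by exact_mod_cast hBpos
  have hr := greedyRemainder_mem hβ.1 hβ.2.le (icc_zero_one_subset hβ hs) m
  have hr' := greedyRemainder_two_mem hs n
  have hXs := digitSum_prefixNat_add_greedyRemainder β s m
  have hY := prefixNat_add_greedyRemainder s n
  have hS := scaledDigitSum_eq (B := B) hQpos (prefixNat (greedyExpansion β s) m) m
  have hXt := hX (prefixNat (greedyExpansion β s) m)
  have h1 := abs_natCast_div_sub_le (scaledDigitSum B Q (prefixNat (greedyExpansion β s) m) m
    * 2 ^ n) (B ^ m)
  have htm : 1 ≤ t ^ m := one_le_pow₀ ht1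
  have e1 : ((scaledDigitSum B Q (prefixNat (greedyExpansion β s) m) m * 2 ^ n : ℕ) : ℝ)
      / ((B ^ m : ℕ) : ℝ)
        = digitSum t (prefixNat (greedyExpansion β s) m) m * (2 ^ n / t ^ m) := by
    push_cast
    rw [hS, ht, ← ht, div_pow]
    field_simp
  rw [e1] at h1
  have hε : (1 : ℝ) / 2 ^ e ≤ 1 := by
    rw [div_le_one (by positivity)]
    exact one_le_pow₀ (by norm_num)
  -- Indeed 2^n ≤ β^m ≤ t^m + 1 ≤ 2 t^m, because t ≥ 1.
  have h2 : 2 ^ n / t ^ m ≤ 2 := by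
    rw [div_le_iff₀ (by positivity)]
    linarith
  have h4 : (β ^ m - t ^ m) * s ∈ Set.Icc (0 : ℝ) 1 := by
    have h40 : 0 ≤ β ^ m - t ^ m := by linarith
    exact ⟨mul_nonneg h40 hs.1, (mul_le_mul (hsub.trans hε) hs.2 hs.1 (by norm_num)).trans_eq
      (by norm_num)⟩
  have h5 : |digitSum t (prefixNat (greedyExpansion β s) m) m - t ^ m * s|
      ≤ 1 / (β - 1) + 2 := by
    rw [abs_le]
    constructor <;> linarith [hr.1, hr.2, hXt.1, hXt.2, h4.1, h4.2]
  have h6 : |digitSum t (prefixNat (greedyExpansion β s) m) m * (2 ^ n / t ^ m) - 2 ^ n * s|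
      ≤ 2 * (1 / (β - 1) + 2) := by
    have : digitSum t (prefixNat (greedyExpansion β s) m) m * (2 ^ n / t ^ m) - 2 ^ n * s
        = 2 ^ n / t ^ m * (digitSum t (prefixNat (greedyExpansion β s) m) m - t ^ m * s) := by
      field_simp
    rw [this, abs_mul, abs_of_pos (by positivity : (0 : ℝ) < 2 ^ n / t ^ m)]
    exact mul_le_mul h2 h5 (abs_nonneg _) (by norm_num)
  rw [abs_le] at h1 h6 ⊢
  constructor <;> linarith [h1.1, h1.2, h6.1, h6.2, hr'.1, hr'.2]

/-- A word that is indistinguishable from a prefix of the greedy expansion has the same value. -/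
theorem digitSum_eq_of_scaledDigitSum_div_eq (hβ : β ∈ Set.Ioo (1 : ℝ) 2) {e : ℕ}
    (hsep : ∀ N N' m : ℕ, digitSum β N m ≠ digitSum β N' m →
      2 / 2 ^ e ≤ |digitSum β N m - digitSum β N' m|) {N N' : ℕ}
    (h : scaledDigitSum (baseNumerator β (2 * m + e)) (2 ^ (2 * m + e)) N m * 2 ^ e
        / (2 ^ (2 * m + e)) ^ m
      = scaledDigitSum (baseNumerator β (2 * m + e)) (2 ^ (2 * m + e)) N' m * 2 ^ e
        / (2 ^ (2 * m + e)) ^ m) : digitSum β N m = digitSum β N' m := by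
  by_contra hne
  have hc := hsep N N' m hne
  obtain ⟨t, ht, -, -, -, hX⟩ := exists_baseApproximation hβ e m
  generalize hB : baseNumerator β (2 * m + e) = B at *
  have hQpos : 0 < 2 ^ (2 * m + e) := by positivity
  generalize hQ : 2 ^ (2 * m + e) = Q at *
  have hQ' : (0 : ℝ) < Q := by exact_mod_cast hQpos
  have e1 : ∀ N, ((scaledDigitSum B Q N m * 2 ^ e : ℕ) : ℝ) / ((Q ^ m : ℕ) : ℝ)
      = 2 ^ e * digitSum t N m := by
    intro N
    push_cast
    rw [scaledDigitSum_eq hQpos, ht]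
    field_simp
  have h1 := abs_div_sub_div_lt_one h
  rw [e1, e1, ← mul_sub, abs_mul, abs_of_pos (by positivity : (0 : ℝ) < 2 ^ e),
    ← lt_div_iff₀' (by positivity)] at h1
  -- Sharing a cell contributes strictly less than 1/2^e. Passing from t to β contributes at most
  -- another 1/2^e, since the corrections of both words lie in the same interval [0, 1/2^e].
  have h2 : (2 : ℝ) / 2 ^ e = 1 / 2 ^ e + 1 / 2 ^ e := by ring
  have h3 : |digitSum β N m - digitSum β N' m| < 2 / 2 ^ e := by
    have hN := hX N
    have hN' := hX N'
    rw [abs_lt] at h1 ⊢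
    constructor <;> linarith [hN.1, hN.2, hN'.1, hN'.2, h1.1, h1.2]
  linarith

/-! ### Comparison of the complexities -/

theorem pair_lt_two_pow {x y s : ℕ} (hx : x < 2 ^ s) (hy : y < 2 ^ s) :
    Nat.pair x y < 2 ^ (2 * s) := by
  refine (Nat.pair_lt_max_add_one_sq x y).trans_le ?_
  rw [mul_comm, pow_mul]
  exact Nat.pow_le_pow_left (max_lt hx hy) 2

/-- A signed correction is stored as two truncated differences, one of which is 0; adding one and
then subtracting the other turns the estimate `a` into the target `b`. -/
theorem add_tsub_tsub_tsub (a b : ℕ) : a + (b - a) - (a - b) = b := by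
  omega

/-- Each pairing doubles the number of bits, and four are nested, whence 16. Self-delimiting the
advice doubles this again, to the 32 in the comparisons below. -/
theorem advice_lt {k n m i j s : ℕ} (hk : k < 2 ^ s) (hn : n < 2 ^ s) (hm : m < 2 ^ s)
    (hi : i < 2 ^ s) (hj : j < 2 ^ s) :
    Nat.pair k (Nat.pair n (Nat.pair m (Nat.pair i j))) < 2 ^ (16 * s) := by
  have hle : ∀ {x r : ℕ}, x < 2 ^ s → s ≤ r → x < 2 ^ r := fun h hr =>
    h.trans_le (Nat.pow_le_pow_right (by norm_num) hr)
  rw [show 16 * s = 2 * (2 * (2 * (2 * s))) by ring]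
  exact pair_lt_two_pow (hle hk (by omega)) (pair_lt_two_pow (hle hn (by omega))
    (pair_lt_two_pow (hle hm (by omega)) (pair_lt_two_pow hi hj)))

variable {U : List Bool → (ℕ → Bool) → Part (List Bool)} {β : ℝ}

/-- The target is an integer within `A` of a computable estimate, so a correction of size at most
`A` recovers it exactly. -/
theorem exists_baseComplexity_binary_le (hU : IsUniversal U) (hβ : β ∈ Set.Ioo (1 : ℝ) 2) :
    ∃ A C : ℕ, ∀ s ∈ Set.Icc (0 : ℝ) 1, ∀ n m r : ℕ, 2 ^ n ≤ β ^ m → 2 * m < 2 ^ r →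
      n < 2 ^ r → A < 2 ^ r →
      baseComplexity U (firstDigits (greedyExpansion 2 s) n) β
        ≤ baseComplexity U (firstDigits (greedyExpansion β s) m) β + 32 * r + C := by
  obtain ⟨C, hC⟩ := exists_complexity_le_add hU computable_binaryFromExpansion
  obtain ⟨A, hA⟩ := exists_nat_ge (2 * (1 / (β - 1) + 2) + 2)
  refine ⟨A, C, fun s hs n m r hnm hm hn hAr => ?_⟩
  have hest := (abs_binary_prediction_sub_le hβ hs hnm 0).trans hA
  set est := scaledDigitSum (baseNumerator β (2 * m + 0)) (2 ^ (2 * m + 0))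
    (prefixNat (greedyExpansion β s) m) m * 2 ^ n / baseNumerator β (2 * m + 0) ^ m with hestdef
  set Y := prefixNat (greedyExpansion 2 s) n with hY
  rw [abs_le] at hest
  have h1 : Y ≤ est + A := by
    have : (Y : ℝ) ≤ est + A := by linarith [hest.2]
    exact_mod_cast this
  have h2 : est ≤ Y + A := by
    have : (est : ℝ) ≤ Y + A := by linarith [hest.1]
    exact_mod_cast this
  have hadv : Nat.pair (2 * m + 0) (Nat.pair n (Nat.pair m (Nat.pair (est - Y) (Y - est))))
      < 2 ^ (16 * r) := advice_lt hm hn (by omega) (by omega) (by omega)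
  have := hC (greedyExpansion 2 (β - 1)) _ _ (firstDigits (greedyExpansion β s) m) hadv
  have hout : binaryFromExpansion ((Nat.pair (2 * m + 0) (Nat.pair n (Nat.pair m
      (Nat.pair (est - Y) (Y - est)))), prefixNat (greedyExpansion 2 (β - 1)) (Nat.pair (2 * m + 0)
        (Nat.pair n (Nat.pair m (Nat.pair (est - Y) (Y - est))))).unpair.1),
        firstDigits (greedyExpansion β s) m) = firstDigits (greedyExpansion 2 s) n := by
    simp only [binaryFromExpansion, Nat.unpair_pair, listNat_firstDigits]
    rw [← baseNumerator, ← hestdef, add_tsub_tsub_tsub est Y, hY,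
      natDigits_prefixNat]
  rw [hout] at this
  exact this.trans_eq (by rw [baseComplexity]; ring)

theorem exists_baseComplexity_expansion_le (hU : IsUniversal U) (hβ : β ∈ Set.Ioo (1 : ℝ) 2)
    (hPisot : IsPisot β) :
    ∃ e A C : ℕ, ∀ s ∈ Set.Icc (0 : ℝ) 1, ∀ n m r : ℕ, β ^ m ≤ 2 * 2 ^ n → 2 * m + e < 2 ^ r →
      n < 2 ^ r → A < 2 ^ r →
      baseComplexity U (firstDigits (greedyExpansion β s) m) β
        ≤ baseComplexity U (firstDigits (greedyExpansion 2 s) n) β + 32 * r + C := by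
  obtain ⟨c, hc, hsep⟩ := hPisot.exists_le_abs_digitSum_sub
  -- Cells of width 2^(-e) with 2 · 2^(-e) ≤ c: words in one cell then have equal values in base β.
  obtain ⟨e, he⟩ := pow_unbounded_of_one_lt (2 / c) (one_lt_two (α := ℝ))
  have hce : 2 / 2 ^ e ≤ c := by
    rw [div_le_iff₀ (by positivity)]
    rw [div_lt_iff₀ hc] at he
    linarith
  obtain ⟨C, hC⟩ := exists_complexity_le_add hU (computable_expansionFromBinary (2 ^ e))
  obtain ⟨A, hA⟩ := exists_nat_ge (2 ^ e * (1 / (β - 1) + 4) + 2)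
  refine ⟨e, A, C, fun s hs n m r hnm hm hn hAr => ?_⟩
  have hest := (abs_expansion_prediction_sub_le hβ hs hnm e).trans hA
  set est := 2 ^ e * baseNumerator β (2 * m + e) ^ m * prefixNat (greedyExpansion 2 s) n
          / ((2 ^ (2 * m + e)) ^ m * 2 ^ n) with hestdef
  set N := prefixNat (greedyExpansion β s) m with hN
  set cell := scaledDigitSum (baseNumerator β (2 * m + e)) (2 ^ (2 * m + e)) N m * 2 ^ e
    / (2 ^ (2 * m + e)) ^ m with hcell
  rw [abs_le] at hest
  have h1 : cell ≤ est + A := by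
    have : (cell : ℝ) ≤ est + A := by linarith [hest.2]
    exact_mod_cast this
  have h2 : est ≤ cell + A := by
    have : (est : ℝ) ≤ cell + A := by linarith [hest.1]
    exact_mod_cast this
  have hadv : Nat.pair (2 * m + e) (Nat.pair n (Nat.pair m
      (Nat.pair (est - cell) (cell - est)))) < 2 ^ (16 * r) :=
    advice_lt hm hn (by omega) (by omega) (by omega)
  have := hC (greedyExpansion 2 (β - 1)) _ _ (firstDigits (greedyExpansion 2 s) n) hadv
  have hlt := prefixNat_lt (greedyExpansion β s) m
  have hout : expansionFromBinary (2 ^ e) ((Nat.pair (2 * m + e) (Nat.pair n (Nat.pair m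
      (Nat.pair (est - cell) (cell - est)))), prefixNat (greedyExpansion 2 (β - 1))
        (Nat.pair (2 * m + e) (Nat.pair n (Nat.pair m
          (Nat.pair (est - cell) (cell - est))))).unpair.1),
        firstDigits (greedyExpansion 2 s) n) = firstDigits (greedyExpansion β s) m := by
    simp only [expansionFromBinary, Nat.unpair_pair, listNat_firstDigits]
    rw [← baseNumerator, ← hestdef, add_tsub_tsub_tsub est cell,
      ← natDigits_prefixNat, ← hN]
    congr 1
    -- The corrected estimate is the cell of `N`, so `N` passes the test. A larger word passing it
    -- would have the same value in base β, contradicting the maximality of the greedy prefix.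
    rw [Nat.findGreatest_eq_iff]
    refine ⟨by omega, fun _ => rfl, fun N' hlt' hle' heq => ?_⟩
    have hval := digitSum_eq_of_scaledDigitSum_div_eq hβ
      (fun N N' m h => hce.trans (hsep N N' m h)) heq
    have := le_prefixNat_of_digitSum_eq hβ.1 hβ.2.le (icc_zero_one_subset hβ hs)
      (by omega) hval
    omega
  rw [hout] at this
  exact this.trans_eq (by rw [baseComplexity]; ring)

/-! ### The number of digits and passage to the limit -/

theorem two_pow_le_pow_digitCount (hβ : β ∈ Set.Ioo (1 : ℝ) 2) (n : ℕ) :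
    2 ^ n ≤ β ^ digitCount β n := by
  have hb : 0 < β := by linarith [hβ.1]
  have h : (n : ℝ) * Real.logb β 2 ≤ digitCount β n := Nat.le_ceil _
  calc (2 : ℝ) ^ n = β ^ ((n : ℝ) * Real.logb β 2) := by
        rw [mul_comm, Real.rpow_mul hb.le, Real.rpow_logb hb hβ.1.ne' two_pos, Real.rpow_natCast]
    _ ≤ β ^ (digitCount β n : ℝ) := Real.rpow_le_rpow_of_exponent_le hβ.1.le h
    _ = β ^ digitCount β n := Real.rpow_natCast _ _

theorem digitCount_lt (hβ : β ∈ Set.Ioo (1 : ℝ) 2) (n : ℕ) :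
    (digitCount β n : ℝ) < n * Real.logb β 2 + 1 :=
  Nat.ceil_lt_add_one (mul_nonneg n.cast_nonneg (Real.logb_nonneg hβ.1 (by norm_num)))

theorem pow_digitCount_le (hβ : β ∈ Set.Ioo (1 : ℝ) 2) (n : ℕ) :
    β ^ digitCount β n ≤ 2 * 2 ^ n := by
  have hb : 0 < β := by linarith [hβ.1]
  calc β ^ digitCount β n = β ^ (digitCount β n : ℝ) := (Real.rpow_natCast _ _).symm
    _ ≤ β ^ ((n : ℝ) * Real.logb β 2 + 1) :=
        Real.rpow_le_rpow_of_exponent_le hβ.1.le (digitCount_lt hβ n).le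
    _ = 2 ^ n * β := by
        rw [Real.rpow_add hb, Real.rpow_one, mul_comm (n : ℝ), Real.rpow_mul hb.le,
          Real.rpow_logb hb hβ.1.ne' two_pos, Real.rpow_natCast]
    _ ≤ 2 * 2 ^ n := by
        rw [mul_comm]
        exact mul_le_mul_of_nonneg_right hβ.2.le (by positivity)

open Filter Topology in
-- The size is the number of binary digits, hence O(log n).
theorem tendsto_size_div (A : ℕ) :
    Tendsto (fun n : ℕ => (Nat.size (A * (n + 1)) : ℝ) / n) atTop (𝓝 0) := by
  have hlog : Tendsto (fun n : ℕ => Real.log n / n) atTop (𝓝 0) :=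
    (Real.isLittleO_log_id_atTop.tendsto_div_nhds_zero).comp tendsto_natCast_atTop_atTop
  have hinv : Tendsto (fun n : ℕ => (1 : ℝ) / n) atTop (𝓝 0) :=
    tendsto_one_div_atTop_nhds_zero_nat
  have hbound : Tendsto (fun n : ℕ => (Real.log n / n + Real.log (2 * (A + 1)) * (1 / n))
      * (Real.log 2)⁻¹ + 1 * (1 / (n : ℝ))) atTop (𝓝 0) := by
    have := ((hlog.add (hinv.const_mul (Real.log (2 * (A + 1))))).mul_const
      (Real.log 2)⁻¹).add (hinv.const_mul 1)
    rwa [mul_zero, mul_zero, add_zero, add_zero, zero_mul] at this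
  refine squeeze_zero' (Eventually.of_forall fun n => by positivity) ?_ hbound
  filter_upwards [eventually_ge_atTop 1] with n hn
  have hn' : (1 : ℝ) ≤ n := by exact_mod_cast hn
  have hsize : (Nat.size (A * (n + 1)) : ℝ) * Real.log 2
      ≤ Real.log n + Real.log (2 * (A + 1)) + Real.log 2 := by
    have hlt : 2 ^ Nat.size (A * (n + 1)) ≤ 2 * ((A + 1) * (n + 1)) := by
      rcases h : Nat.size (A * (n + 1)) with _ | r
      · have : 0 < (A + 1) * (n + 1) := by positivity
        omega
      · have := Nat.lt_size.1 (show r < Nat.size (A * (n + 1)) by omega)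
        rw [pow_succ, mul_comm]
        exact Nat.mul_le_mul_left 2 (this.trans (Nat.mul_le_mul_right _ (Nat.le_succ A)))
    have hlt' : (2 : ℝ) ^ Nat.size (A * (n + 1)) ≤ n * (2 * (A + 1)) * 2 := by
      calc (2 : ℝ) ^ Nat.size (A * (n + 1)) ≤ 2 * ((A + 1) * (n + 1)) := by exact_mod_cast hlt
        _ ≤ 2 * ((A + 1) * (n + n)) := by gcongr
        _ = n * (2 * (A + 1)) * 2 := by ring
    rw [← Real.log_mul (by positivity) (by positivity),
      ← Real.log_mul (by positivity) (by positivity), ← Real.log_pow]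
    exact Real.log_le_log (by positivity) hlt'
  have hl2 : 0 < Real.log 2 := Real.log_pos one_lt_two
  rw [div_le_iff₀ (by linarith)]
  have heq : ((Real.log n / n + Real.log (2 * (A + 1)) * (1 / n)) * (Real.log 2)⁻¹
      + 1 * (1 / (n : ℝ))) * n
      = (Real.log n + Real.log (2 * (A + 1)) + Real.log 2) / Real.log 2 := by
    field_simp
  rw [heq, le_div_iff₀ hl2]
  exact hsize

open Filter Topology in
theorem tendsto_complexityGap (hU : IsUniversal U) (hβ : β ∈ Set.Ioo (1 : ℝ) 2)
    (hPisot : IsPisot β) {s : ℝ} (hs : s ∈ Set.Icc (0 : ℝ) 1) :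
    Tendsto (complexityGap U β (greedyExpansion β s)) atTop (𝓝 0) := by
  obtain ⟨A₁, C₁, h₁⟩ := exists_baseComplexity_binary_le hU hβ
  obtain ⟨e, A₂, C₂, h₂⟩ := exists_baseComplexity_expansion_le hU hβ hPisot
  obtain ⟨M, hM⟩ := exists_nat_ge (Real.logb β 2)
  have hvalue : value β (greedyExpansion β s) = s :=
    (isExpansion_greedyExpansion hβ.1 hβ.2.le (icc_zero_one_subset hβ hs)).tsum_eq
  -- Chosen so that A(n + 1) dominates every component of both advices; its binary size `r` then
  -- serves as the common bit bound.
  set A := A₁ + A₂ + e + 2 * M + 2 with hA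
  have hbound : Tendsto (fun n : ℕ => 32 * ((Nat.size (A * (n + 1)) : ℝ) / n)
      + (C₁ + C₂) * (1 / n)) atTop (𝓝 0) := by
    simpa using ((tendsto_size_div A).const_mul 32).add
      ((tendsto_one_div_atTop_nhds_zero_nat (𝕜 := ℝ)).const_mul ((C₁ : ℝ) + C₂))
  refine squeeze_zero_norm (fun n => ?_) hbound
  have hr : A * (n + 1) < 2 ^ Nat.size (A * (n + 1)) := Nat.lt_size_self _
  set r := Nat.size (A * (n + 1))
  have hm : digitCount β n ≤ n * M + 1 := by
    have h : (digitCount β n : ℝ) ≤ n * M + 1 :=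
      (digitCount_lt hβ n).le.trans (by gcongr)
    exact_mod_cast h
  have hexp : A * (n + 1) = A₁ * n + A₂ * n + e * n + 2 * (n * M) + 2 * n
      + A₁ + A₂ + e + 2 * M + 2 := by rw [hA]; ring
  have hle₁ := h₁ s hs n (digitCount β n) r (two_pow_le_pow_digitCount hβ n)
    (by omega) (by omega) (by omega)
  have hle₂ := h₂ s hs n (digitCount β n) r (pow_digitCount_le hβ n)
    (by omega) (by omega) (by omega)
  rw [complexityGap, hvalue, Real.norm_eq_abs, abs_div, Nat.abs_cast,
    show 32 * ((r : ℝ) / n) + (C₁ + C₂) * (1 / n) = (32 * r + (C₁ + C₂)) / n by ring]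
  refine div_le_div_of_nonneg_right ?_ n.cast_nonneg
  have hc₁ : (baseComplexity U (firstDigits (greedyExpansion 2 s) n) β : ℝ)
      ≤ baseComplexity U (firstDigits (greedyExpansion β s) (digitCount β n)) β
        + 32 * r + C₁ := by exact_mod_cast hle₁
  have hc₂ : (baseComplexity U (firstDigits (greedyExpansion β s) (digitCount β n)) β : ℝ)
      ≤ baseComplexity U (firstDigits (greedyExpansion 2 s) n) β + 32 * r + C₂ := by
    exact_mod_cast hle₂
  have h01 : (0 : ℝ) ≤ C₁ := C₁.cast_nonneg
  have h02 : (0 : ℝ) ≤ C₂ := C₂.cast_nonneg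
  rw [abs_le]
  constructor <;> linarith

end BetaExpansion
end

theorem mainTheorem7 (U : List Bool → (ℕ → Bool) → Part (List Bool))
    (hU : BetaExpansion.IsUniversal U) (β : ℝ) (hβ : β ∈ Set.Ioo (1 : ℝ) 2)
    (hPisot : BetaExpansion.IsPisot β) (s : ℝ) (hs : s ∈ Set.Icc (0 : ℝ) 1) (x : ℕ → Bool)
    (hx : BetaExpansion.IsGreedyExpansion β s x) :
    BetaExpansion.lowerDelta U β x = 0 ∧ BetaExpansion.upperDelta U β x = 0 := by
  obtain rfl := (BetaExpansion.isGreedyExpansion_iff hβ.1 hβ.2.le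
    (BetaExpansion.icc_zero_one_subset hβ hs) x).1 hx
  have h := (continuous_coe_real_ereal.tendsto 0).comp
    (BetaExpansion.tendsto_complexityGap hU hβ hPisot hs)
  exact ⟨h.liminf_eq, h.limsup_eq⟩
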